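/- For a lattice $L=\mathbb Z\omega_1+\mathbb Z\omega_2\subset\mathbb C$ (with $\omega_1,\omega_2$ linearly independent over $\mathbb R$; such a pair is called a pair of basic periods of $L$) put $$g_2(L)=60\sum_{0\ne\omega\in L}\omega^{-4},\qquad g_3(L)=140\sum_{0\ne\omega\in L}\omega^{-6},\qquad J(L)=\frac{g_2(L)^3}{g_2(L)^3-27g_3(L)^2}.$$ For $\tau$ in the upper half plane let $L_\tau=\mathbb Z+\mathbb Z\tau$ and $J(\tau)=J(L_\tau)$. If $J=J(\tau)\notin\{0,1\}$, the normalized lattice is $L_J=\mu\cdot L_\tau$, where $\mu^2=g_3(L_\tau)/g_2(L_\tau)$. **Theorem (Picard–Fuchs).** For every $\tau$ with $J(\tau)\notin\{0,1\}$ a normalized lattice $L_J$ with $J=J(\tau)$ exists, and every normalized lattice $L_J$, $J\notin\{0,1\}$, satisfies $g_2(L_J)=g_3(L_J)=\frac{27J}{J-1}$. The basic periods of $L_J$ are locally functions of $J$: for every $J_0\notin\{0,1\}$ and every pair of basic periods $(\omega_1,\omega_2)$ of a normalized lattice $L_{J_0}$ there are an open neighbourhood $U\subset\mathbb C\setminus\{0,1\}$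 of $J_0$ and continuous functions $\Omega_1,\Omega_2:U\to\mathbb C$ with $(\Omega_1(J_0),\Omega_2(J_0))=(\omega_1,\omega_2)$ such that $(\Omega_1(J),\Omega_2(J))$ is a pair of basic periods of a normalized lattice $L_J$ for each $J\in U$. Moreover, for every open $U\subset\mathbb C\setminus\{0,1\}$ and all continuous $\Omega_1,\Omega_2:U\to\mathbb C$ such that $(\Omega_1(J),\Omega_2(J))$ is a pair of basic periods of a normalized lattice $L_J$ for each $J\in U$, both functions are holomorphic on $U$, and each $\Omega\in\{\Omega_1,\Omega_2\}$ satisfies on $U$ $$\frac{d^2\Omega}{dJ^2}+\frac1J\cdot\frac{d\Omega}{dJ}+\frac{31J-4}{144J^2(J-1)^2}\cdot\Omega=0.$$ -/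

import Mathlib

/-- The period pair `(1, τ)`, whose lattice is `L_τ = ℤ + ℤ τ`, for `τ` in the upper half plane. -/
noncomputable def tauPair (τ : UpperHalfPlane) : PeriodPair where
  ω₁ := 1
  ω₂ := (τ : ℂ)
  indep := by
    rw [LinearIndependent.pair_iff]
    intro s t h
    have him := congrArg Complex.im h
    have hre := congrArg Complex.re h
    simp at him hre
    have hτ : t = 0 := him.resolve_right τ.im_pos.ne'
    subst hτ
    simpa using hre

/-- Klein's absolute invariant `J(L) = g₂³ / (g₂³ - 27 g₃²)` of the lattice spanned by `L`. -/
noncomputable def kleinJ (L : PeriodPair) : ℂ :=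
  L.g₂ ^ 3 / (L.g₂ ^ 3 - 27 * L.g₃ ^ 2)

/-- `(L.ω₁, L.ω₂)` is a pair of basic periods of the normalized lattice `L_J = μ(τ) · L_τ`, where
`J = J(τ)` and `μ(τ)` is a square root of `g₃(L_τ) / g₂(L_τ)`.
(Used only for `J ≠ 0, 1`, that is, where `g₂(L_τ)` and `g₃(L_τ)` are both nonzero.) -/
def IsNormalizedPair (J : ℂ) (L : PeriodPair) : Prop :=
  ∃ (τ : UpperHalfPlane) (μ : ℂ),
    kleinJ (tauPair τ) = J ∧
    μ ^ 2 = (tauPair τ).g₃ / (tauPair τ).g₂ ∧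
    (L.lattice : Set ℂ) = (fun z : ℂ => μ * z) '' ((tauPair τ).lattice : Set ℂ)

/-- A continuous choice `J ↦ ((L J).ω₁, (L J).ω₂)` of basic periods of `L_J` on `U`. -/
def IsPeriodBranch (U : Set ℂ) (L : ℂ → PeriodPair) : Prop :=
  ContinuousOn (fun J => (L J).ω₁) U ∧ ContinuousOn (fun J => (L J).ω₂) U ∧
    ∀ J ∈ U, IsNormalizedPair J (L J)

/-- `Ω` is a holomorphic solution on the open set `U` of
`Ω'' + Ω' / J + (31 J - 4) / (144 J² (J - 1)²) · Ω = 0`. -/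
def SolvesPicardFuchs (U : Set ℂ) (Ω : ℂ → ℂ) : Prop :=
  DifferentiableOn ℂ Ω U ∧
    ∀ J ∈ U, deriv (deriv Ω) J + 1 / J * deriv Ω J
      + (31 * J - 4) / (144 * J ^ 2 * (J - 1) ^ 2) * Ω J = 0

open UpperHalfPlane hiding I
open Real Complex Filter Topology
open scoped Manifold MatrixGroups ModularForm Derivative

/-! Up to powers of π, `g₂` and `g₃` of `L_τ` are `E₄` and `E₆`. By homogeneity a positively
oriented basic pair of `L_J` is `(a, a * τ)` with `a ^ 2 = 2 / 9 * π ^ 2 * E₆ / E₄`. Ramanujan's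
identities give the `τ`-derivatives of `E2`, `E₄`, `E₆`; since `dJ/dτ ≠ 0` for `J ≠ 0, 1`, they
become derivatives in `J`.

Put `X = E2 * E₄ / E₆`. The logarithmic derivative of `a` is affine in `X` (`hasDerivAt_period`),
and `X` satisfies a Riccati equation with coefficients rational in `J` (`hasDerivAt_eisensteinX`).
In `a'' + a' / J` all terms in `X` cancel, which leaves the Picard–Fuchs equation. As `J * a ^ 2 *
τ'` is constant, `a * τ` is a second solution by reduction of order.

Continuity suffices for holomorphy: `τ` is a local inverse of `J`, and `a` is a square root of a
holomorphic function. The same two facts construct the local branches. -/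

/-! ### Behaviour at `i∞` and vanishing in weight below twelve -/

/-- A holomorphic function on the upper half plane that tends to a limit at `i∞` has a derivative
that tends to zero there. -/
theorem tendsto_normalizedDeriv_atImInfty {f : ℍ → ℂ} (hf : MDiff f) {c : ℂ}
    (hc : Tendsto f atImInfty (𝓝 c)) :
    Tendsto (Derivative.normalizedDerivOfComplex f) atImInfty (𝓝 0) := by
  rw [UpperHalfPlane.mdifferentiable_iff] at hf
  suffices h : Tendsto (fun z : ℍ ↦ deriv (f ∘ ofComplex) z) atImInfty (𝓝 0) by
    have h' := h.const_mul ((2 * π * I : ℂ)⁻¹)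
    rwa [mul_zero] at h'
  rw [Metric.tendsto_nhds] at hc ⊢
  intro ε hε
  obtain ⟨A, hA⟩ := (atImInfty_mem _).mp (hc (ε / 2) (half_pos hε))
  -- The extra `1` keeps the unit disc about `z` inside the region where `f` is close to `c`, so
  -- Cauchy's estimate with radius `1` applies.
  refine (atImInfty_mem _).mpr ⟨max A 1 + 1, fun z hz ↦ ?_⟩
  have him : ∀ w ∈ Metric.closedBall (z : ℂ) 1, max A 1 ≤ w.im := by
    intro w hw
    have h1 := (abs_im_le_norm (w - z)).trans (by simpa [dist_eq_norm] using hw)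
    rw [sub_im, abs_le] at h1
    have : (z : ℂ).im = z.im := rfl
    linarith [h1.1]
  have hpos : ∀ w ∈ Metric.closedBall (z : ℂ) 1, 0 < w.im := fun w hw ↦
    lt_of_lt_of_le one_pos ((le_max_right A 1).trans (him w hw))
  have hd : DiffContOnCl ℂ (fun w ↦ (f ∘ ofComplex) w - c) (Metric.ball (z : ℂ) 1) := by
    refine DifferentiableOn.diffContOnCl ?_
    rw [closure_ball _ one_ne_zero]
    exact (hf.mono fun w hw ↦ hpos w hw).sub_const c
  have hb := Complex.norm_deriv_le_of_forall_mem_sphere_norm_le (C := ε / 2) one_pos hd (by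
    intro w hw
    have hw' := Metric.sphere_subset_closedBall hw
    have : dist (f ⟨w, hpos w hw'⟩) c < ε / 2 := hA _ ((le_max_left A 1).trans (him w hw'))
    simpa [ofComplex_apply_of_im_pos (hpos w hw'), dist_eq_norm] using this.le)
  have : deriv (fun w ↦ (f ∘ ofComplex) w - c) z = deriv (f ∘ ofComplex) z := by
    rw [deriv_sub_const_fun]
  rw [this, div_one] at hb
  change dist _ _ < ε
  rw [dist_zero_right]
  linarith

/-- Reduces each Ramanujan identity to modularity and a limit at `i∞`. -/
theorem eq_zero_of_slash_eq_of_weight_lt_twelve {k : ℤ} (hk : k < 12) {f : ℍ → ℂ} (hf : MDiff f)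
    (hs : ∀ γ : SL(2, ℤ), f ∣[k] γ = f) (h0 : Tendsto f atImInfty (𝓝 0)) : f = 0 := by
  let F : CuspForm 𝒮ℒ k :=
    { toFun := f
      slash_action_eq' := fun _ ⟨γ, hγ⟩ ↦ hγ ▸ hs γ
      holo' := hf
      zero_at_cusps' {c} hc := by
        rw [Subgroup.IsArithmetic.isCusp_iff_isCusp_SL2Z] at hc
        rw [OnePoint.isZeroAt_iff_forall_SL2Z hc]
        intro γ _
        rw [hs γ]
        exact h0 }
  have hF : F = 0 := rank_zero_iff_forall_zero.mp (CuspForm.rank_eq_zero_of_weight_lt_twelve hk) F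
  exact congrArg DFunLike.coe hF

/-- `(f - c 0) / q` is again a `q`-series, hence bounded at `i∞`, while `q` tends to `0`. Modularity
plays no role, so `E2` is covered. -/
theorem tendsto_atImInfty_of_hasSum_qExpansion {f : ℍ → ℂ} {c : ℕ → ℂ}
    (hf : ∀ τ : ℍ, HasSum (fun m ↦ c m • Function.Periodic.qParam 1 τ ^ m) (f τ)) :
    Tendsto f atImInfty (𝓝 (c 0)) := by
  have hg : IsBoundedAtImInfty
      (fun τ : ℍ ↦ (f τ - c 0) / Function.Periodic.qParam 1 τ) := by
    refine isBoundedAtImInfty_of_hasSum_qExpansion (c := fun m ↦ c (m + 1)) one_pos fun τ ↦ ?_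
    have h := (hasSum_nat_add_iff' 1).mpr (hf τ)
    have hq : Function.Periodic.qParam 1 (τ : ℂ) ≠ 0 := Complex.exp_ne_zero _
    convert! h.div_const (Function.Periodic.qParam 1 (τ : ℂ)) using 1
    · funext m
      simp only [smul_eq_mul, pow_succ]
      field_simp
    · simp
  have hz : Tendsto (fun τ : ℍ ↦ Function.Periodic.qParam 1 (τ : ℂ)) atImInfty (𝓝 0) :=
    (qParam_tendsto_atImInfty one_pos)
  have h := (hz.zero_mul_isBoundedUnder_le (Asymptotics.IsBigO.isBoundedUnder_le hg)).add_const
    (c 0)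
  rw [zero_add] at h
  refine h.congr fun τ ↦ ?_
  have hq : Function.Periodic.qParam 1 (τ : ℂ) ≠ 0 := Complex.exp_ne_zero _
  field_simp
  ring

theorem tendsto_E_atImInfty {k : ℕ} (hk : 3 ≤ k) (hk2 : Even k) :
    Tendsto (ModularForm.E hk) atImInfty (𝓝 1) := by
  rw [← EisensteinSeries.E_qExpansion_coeff_zero hk hk2]
  exact tendsto_atImInfty_of_hasSum_qExpansion fun τ ↦
    (ModularForm.hasSum_qExpansion (ModularForm.E hk) one_pos one_mem_strictPeriods_SL τ)

theorem tendsto_E2_atImInfty : Tendsto EisensteinSeries.E2 atImInfty (𝓝 1) := by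
  have h := tendsto_atImInfty_of_hasSum_qExpansion (f := EisensteinSeries.E2) fun τ ↦ by
    simpa only [Function.Periodic.qParam, ofReal_one, div_one] using
      EisensteinSeries.hasSum_qExpansion_E2 (z := τ)
  simpa using h

/-! ### Ramanujan's identities -/

open Derivative EisensteinSeries ModularForm

theorem serreDerivative_E_tendsto {k : ℕ} (hk : 3 ≤ k) (hk2 : Even k) :
    Tendsto (serreDerivative k (E hk)) atImInfty (𝓝 (-(k / 12))) := by
  have h := (tendsto_normalizedDeriv_atImInfty (ModularFormClass.holo (E hk))
    (tendsto_E_atImInfty hk hk2)).sub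
    ((tendsto_E2_atImInfty.const_mul ((k : ℂ) * 12⁻¹)).mul (tendsto_E_atImInfty hk hk2))
  simpa [div_eq_mul_inv] using h

theorem levelOne_slash_eq {k : ℤ} (f : ModularForm 𝒮ℒ k) (γ : SL(2, ℤ)) : ⇑f ∣[k] γ = f :=
  SlashInvariantFormClass.slash_action_eq f _ ⟨γ, rfl⟩

/-- Ramanujan's identity for the derivative of `E₄`. -/
theorem serreDerivative_E₄ (z : ℍ) : serreDerivative 4 E₄ z = -(1 / 3) * E₆ z := by
  have hd : MDiff (serreDerivative 4 E₄) :=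
    serreDerivative_mdifferentiable _ (ModularFormClass.holo E₄)
  have h := eq_zero_of_slash_eq_of_weight_lt_twelve (k := 6) (by norm_num)
    (f := serreDerivative 4 E₄ + (1 / 3 : ℂ) • ⇑E₆)
    (hd.add ((ModularFormClass.holo E₆).const_smul _)) (fun γ ↦ ?_) ?_
  · exact eq_neg_of_add_eq_zero_left (congrFun h z) |>.trans (by simp)
  · rw [SlashAction.add_slash, SL_smul_slash, levelOne_slash_eq E₆]
    congr 1
    exact serreDerivative_slash_invariant (k := 4) (ModularFormClass.holo E₄)
      (levelOne_slash_eq E₄ γ)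
  · have := (serreDerivative_E_tendsto (k := 4) (by norm_num) (by decide)).add
      ((tendsto_E_atImInfty (k := 6) (by norm_num) (by decide)).const_mul (1 / 3 : ℂ))
    norm_num at this ⊢
    exact this

/-- Ramanujan's identity for the derivative of `E₆`. -/
theorem serreDerivative_E₆ (z : ℍ) : serreDerivative 6 E₆ z = -(1 / 2) * E₄ z ^ 2 := by
  have hd : MDiff (serreDerivative 6 E₆) :=
    serreDerivative_mdifferentiable _ (ModularFormClass.holo E₆)
  have h := eq_zero_of_slash_eq_of_weight_lt_twelve (k := 8) (by norm_num)
    (f := serreDerivative 6 E₆ + (1 / 2 : ℂ) • (⇑E₄ * ⇑E₄))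
    (hd.add (((ModularFormClass.holo E₄).mul (ModularFormClass.holo E₄)).const_smul _))
    (fun γ ↦ ?_) ?_
  · exact eq_neg_of_add_eq_zero_left (congrFun h z) |>.trans (by simp [sq])
  · rw [SlashAction.add_slash, SL_smul_slash]
    congr 2
    · exact serreDerivative_slash_invariant (k := 6) (ModularFormClass.holo E₆)
        (levelOne_slash_eq E₆ γ)
    · exact (mul_slash_SL2 4 4 γ _ _).trans (by rw [levelOne_slash_eq E₄])
  · have h4 := tendsto_E_atImInfty (k := 4) (by norm_num) (by decide)
    have := (serreDerivative_E_tendsto (k := 6) (by norm_num) (by decide)).add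
      ((h4.mul h4).const_mul (1 / 2 : ℂ))
    norm_num at this ⊢
    exact this

theorem E2_slash_apply (γ : SL(2, ℤ)) (z : ℍ) :
    (E2 ∣[(2 : ℤ)] γ) z = E2 z + 12 * (2 * π * I)⁻¹ * (γ 1 0 / denom γ z) := by
  have hπ : (π : ℂ) ≠ 0 := ofReal_ne_zero.mpr pi_ne_zero
  rw [E2_slash_action]
  simp only [Pi.sub_apply, Pi.smul_apply, smul_eq_mul, D2, riemannZeta_two]
  have hd := denom_ne_zero γ z
  field_simp
  linear_combination (-12 * (γ 1 0 : ℂ)) * I_sq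

/-- Differentiates the anomaly in `E2_slash_apply`. -/
theorem normalizedDeriv_E2_slash (γ : SL(2, ℤ)) (z : ℍ) :
    normalizedDerivOfComplex (E2 ∣[(2 : ℤ)] γ) z = normalizedDerivOfComplex E2 z -
      12 * (2 * π * I)⁻¹ ^ 2 * (γ 1 0 / denom γ z) ^ 2 := by
  have h1 := (mdifferentiableAt_iff.mp (E2_mdifferentiable z)).hasDerivAt
  have h2 := (hasDerivAt_denom_zpow (γ : GL (Fin 2) ℝ) (-1) z).const_mul
    (12 * (2 * π * I)⁻¹ * (γ 1 0 : ℂ))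
  have h3 := (h1.add h2).congr_of_eventuallyEq (f₁ := (E2 ∣[(2 : ℤ)] γ) ∘ ofComplex) (by
    filter_upwards [isOpen_upperHalfPlaneSet.mem_nhds z.im_pos] with w hw
    simp only [Function.comp_apply, Pi.add_apply, E2_slash_apply,
      ofComplex_apply_of_im_pos hw, zpow_neg_one]
    ring_nf)
  rw [normalizedDerivOfComplex, h3.deriv, normalizedDerivOfComplex]
  have hd := denom_ne_zero γ z
  norm_num
  ring

/-- Ramanujan's identity for the derivative of `E₂`. -/
theorem serreDerivative_E2 (z : ℍ) : serreDerivative 1 E2 z = -(1 / 12) * E₄ z := by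
  have hd : MDiff (serreDerivative 1 E2) := serreDerivative_mdifferentiable _ E2_mdifferentiable
  have h := eq_zero_of_slash_eq_of_weight_lt_twelve (k := 4) (by norm_num)
    (f := serreDerivative 1 E2 + (1 / 12 : ℂ) • ⇑E₄)
    (hd.add ((ModularFormClass.holo E₄).const_smul _)) (fun γ ↦ ?_) ?_
  · exact eq_neg_of_add_eq_zero_left (congrFun h z) |>.trans (by simp)
  · rw [SlashAction.add_slash, SL_smul_slash, levelOne_slash_eq E₄]
    congr 1
    ext w
    -- The anomalies of the derivative of `E2` and of `E2 ^ 2 / 12` cancel; this is why the Serre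
    -- derivative has parameter `1` although `E2` has weight `2`.
    have h1 := congrFun (normalizedDerivOfComplex_SL_slash (k := 2) E2_mdifferentiable (γ := γ)) w
    have h2 := normalizedDeriv_E2_slash γ w
    have h3 := E2_slash_apply γ w
    have h4 : ((E2 * E2) ∣[(4 : ℤ)] γ) w = (E2 ∣[(2 : ℤ)] γ) w * (E2 ∣[(2 : ℤ)] γ) w :=
      congrFun (mul_slash_SL2 2 2 γ E2 E2) w
    have h5 : serreDerivative 1 E2 =
        normalizedDerivOfComplex E2 + (-(1 / 12) : ℂ) • (E2 * E2) := by
      ext u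
      simp only [serreDerivative_apply, Pi.add_apply, Pi.smul_apply, Pi.mul_apply, smul_eq_mul]
      ring
    rw [h5, SlashAction.add_slash, SL_smul_slash]
    simp only [Pi.add_apply, Pi.smul_apply, Pi.mul_apply, smul_eq_mul, h4]
    rw [Pi.sub_apply, h2, h3] at h1
    rw [h3]
    push_cast at h1
    linear_combination -h1
  · have := ((tendsto_normalizedDeriv_atImInfty E2_mdifferentiable
      tendsto_E2_atImInfty).sub ((tendsto_E2_atImInfty.const_mul ((1 : ℂ) * 12⁻¹)).mul
        tendsto_E2_atImInfty)).add
      ((tendsto_E_atImInfty (k := 4) (by norm_num) (by decide)).const_mul (1 / 12 : ℂ))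
    norm_num at this ⊢
    exact this

/-! ### Scaling and orientation of period pairs -/

namespace PeriodPair

theorem G_of_lattice_eq_image {L L' : PeriodPair} {c : ℂ} (hc : c ≠ 0)
    (h : (L.lattice : Set ℂ) = (fun z : ℂ => c * z) '' (L'.lattice : Set ℂ)) (n : ℕ) :
    L.G n = (c ^ n)⁻¹ * L'.G n := by
  have h1 : L.G n = ∑' l : (L.lattice : Set ℂ), ((l : ℂ) ^ n)⁻¹ := rfl
  have h2 : L'.G n = ∑' l : (L'.lattice : Set ℂ), ((l : ℂ) ^ n)⁻¹ := rfl
  rw [h1, h, tsum_image (fun x : ℂ ↦ (x ^ n)⁻¹) (mul_right_injective₀ hc).injOn, h2,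
    ← tsum_mul_left]
  simp_rw [mul_pow, mul_inv]

theorem g₂_of_lattice_eq_image {L L' : PeriodPair} {c : ℂ} (hc : c ≠ 0)
    (h : (L.lattice : Set ℂ) = (fun z : ℂ => c * z) '' (L'.lattice : Set ℂ)) :
    L.g₂ = (c ^ 4)⁻¹ * L'.g₂ := by
  rw [g₂, g₂, G_of_lattice_eq_image hc h]
  ring

theorem g₃_of_lattice_eq_image {L L' : PeriodPair} {c : ℂ} (hc : c ≠ 0)
    (h : (L.lattice : Set ℂ) = (fun z : ℂ => c * z) '' (L'.lattice : Set ℂ)) :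
    L.g₃ = (c ^ 6)⁻¹ * L'.g₃ := by
  rw [g₃, g₃, G_of_lattice_eq_image hc h]
  ring

theorem ω₁_ne_zero (L : PeriodPair) : L.ω₁ ≠ 0 := L.indep.ne_zero 0

theorem ω₂_ne_zero (L : PeriodPair) : L.ω₂ ≠ 0 := L.indep.ne_zero 1

theorem im_div_ne_zero (L : PeriodPair) : (L.ω₂ / L.ω₁).im ≠ 0 := by
  intro h
  have h1 := L.indep
  rw [LinearIndependent.pair_iff] at h1
  have h2 : L.ω₂ / L.ω₁ = ((L.ω₂ / L.ω₁).re : ℂ) := Complex.ext (by simp) (by simp [h])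
  have h3 := h1 ((L.ω₂ / L.ω₁).re) (-1) (by
    rw [Complex.real_smul, ← h2, div_mul_cancel₀ _ L.ω₁_ne_zero]
    simp)
  simpa using h3.2

theorem eq_of_periods_eq {L L' : PeriodPair} (h₁ : L.ω₁ = L'.ω₁) (h₂ : L.ω₂ = L'.ω₂) : L = L' := by
  cases L
  cases L'
  subst h₁ h₂
  rfl

/-- The same lattice with its two basic periods exchanged. -/
def swap (L : PeriodPair) : PeriodPair where
  ω₁ := L.ω₂
  ω₂ := L.ω₁
  indep := by
    rw [LinearIndependent.pair_symm_iff]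
    exact L.indep

theorem swap_lattice (L : PeriodPair) : L.swap.lattice = L.lattice := by
  rw [lattice, lattice, swap, Set.pair_comm]

theorem im_swap_div_pos {L : PeriodPair} (h : ¬ 0 < (L.ω₂ / L.ω₁).im) :
    0 < (L.swap.ω₂ / L.swap.ω₁).im := by
  have h1 : (L.ω₂ / L.ω₁).im < 0 := lt_of_le_of_ne (not_lt.mp h) L.im_div_ne_zero
  change 0 < (L.ω₁ / L.ω₂).im
  rw [← inv_div, inv_im]
  exact div_pos (neg_pos.mpr h1) (normSq_pos.mpr (div_ne_zero L.ω₂_ne_zero L.ω₁_ne_zero))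

/-- The period pair `(μ, μ τ)`. -/
noncomputable def ofTau (τ : ℍ) (μ : ℂ) (hμ : μ ≠ 0) : PeriodPair where
  ω₁ := μ
  ω₂ := μ * τ
  indep := by
    have h := (tauPair τ).indep
    rw [LinearIndependent.pair_iff] at h ⊢
    intro s t hst
    refine h s t (mul_left_cancel₀ hμ ?_)
    simp only [tauPair, real_smul] at hst ⊢
    linear_combination hst

theorem lattice_eq_image_of_tau {L : PeriodPair} {τ : ℍ} (h : L.ω₂ = L.ω₁ * τ) :
    (L.lattice : Set ℂ) = (fun z : ℂ => L.ω₁ * z) '' ((tauPair τ).lattice : Set ℂ) := by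
  ext x
  simp only [SetLike.mem_coe, Set.mem_image, mem_lattice, tauPair, h]
  constructor
  · rintro ⟨m, n, rfl⟩
    exact ⟨m * 1 + n * τ, ⟨m, n, rfl⟩, by ring⟩
  · rintro ⟨_, ⟨m, n, rfl⟩, rfl⟩
    exact ⟨m, n, by ring⟩

end PeriodPair

/-! ### Lattice invariants as Eisenstein series -/

theorem tauPair_G_eq_tsum_eisSummand (τ : ℍ) (k : ℕ) :
    (tauPair τ).G k = ∑' v : Fin 2 → ℤ, eisSummand k v τ := by
  -- `eisSummand` puts the coefficient of `τ` first, `tauPair` the coefficient of `1`; hence the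
  -- exchange of coordinates.
  rw [PeriodPair.G, ← (tauPair τ).latticeEquivProd.symm.toEquiv.tsum_eq,
    ← ((finTwoArrowEquiv ℤ).trans (Equiv.prodComm ℤ ℤ)).tsum_eq]
  refine tsum_congr fun v ↦ ?_
  have h := (tauPair τ).latticeEquiv_symm_apply (v 1, v 0)
  change (((tauPair τ).latticeEquivProd.symm (v 1, v 0) : ℂ) ^ k)⁻¹ = _
  rw [h]
  simp [tauPair, eisSummand, add_comm]

theorem tauPair_G_eq {k : ℕ} (hk : 3 ≤ k) (τ : ℍ) :
    (tauPair τ).G k = 2 * riemannZeta k * E hk τ := by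
  rw [tauPair_G_eq_tsum_eisSummand, tsum_eisSummand_eq_riemannZeta_mul_eisensteinSeries hk]
  have : E hk τ = (1 / 2 : ℂ) * eisensteinSeries (N := 1) 0 k τ := rfl
  rw [this]
  ring

theorem tauPair_g₂ (τ : ℍ) : (tauPair τ).g₂ = 4 / 3 * π ^ 4 * E₄ τ := by
  rw [PeriodPair.g₂, tauPair_G_eq (by norm_num), Nat.cast_ofNat, riemannZeta_four]
  ring

theorem riemannZeta_six : riemannZeta 6 = π ^ 6 / 945 := by
  have h := riemannZeta_two_mul_nat (k := 3) (by norm_num)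
  norm_num [show bernoulli 6 = 1 / 42 by decide +kernel, Nat.factorial] at h
  rw [h]
  ring

theorem tauPair_g₃ (τ : ℍ) : (tauPair τ).g₃ = 8 / 27 * π ^ 6 * E₆ τ := by
  rw [PeriodPair.g₃, tauPair_G_eq (by norm_num), Nat.cast_ofNat, riemannZeta_six]
  ring

theorem kleinJ_tauPair (τ : ℍ) : kleinJ (tauPair τ) = E₄ τ ^ 3 / (E₄ τ ^ 3 - E₆ τ ^ 2) := by
  -- Both `(4 / 3) ^ 3` and `27 * (8 / 27) ^ 2` equal `64 / 27`.
  have hπ : (64 / 27 * π ^ 12 : ℂ) ≠ 0 := by simp [pi_ne_zero]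
  rw [kleinJ, tauPair_g₂, tauPair_g₃, ← mul_div_mul_left (E₄ τ ^ 3) _ hπ]
  ring

/-! ### Derivatives in `τ` -/

theorem hasDerivAt_comp_ofComplex {f : ℍ → ℂ} (hf : MDiff f) (z : ℍ) :
    HasDerivAt (f ∘ ofComplex) (2 * π * I * normalizedDerivOfComplex f z) z := by
  have h := (mdifferentiableAt_iff.mp (hf z)).hasDerivAt
  exact h.congr_deriv (mul_inv_cancel_left₀ two_pi_I_ne_zero _).symm

theorem hasDerivAt_E₄ (z : ℍ) :
    HasDerivAt (E₄ ∘ ofComplex) (2 * π * I * ((E2 z * E₄ z - E₆ z) / 3)) z := by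
  convert hasDerivAt_comp_ofComplex (ModularFormClass.holo E₄) z using 2
  have h := serreDerivative_E₄ z
  rw [serreDerivative_apply] at h
  linear_combination -h

theorem hasDerivAt_E₆ (z : ℍ) :
    HasDerivAt (E₆ ∘ ofComplex) (2 * π * I * ((E2 z * E₆ z - E₄ z ^ 2) / 2)) z := by
  convert hasDerivAt_comp_ofComplex (ModularFormClass.holo E₆) z using 2
  have h := serreDerivative_E₆ z
  rw [serreDerivative_apply] at h
  linear_combination -h

theorem hasDerivAt_E2 (z : ℍ) :
    HasDerivAt (E2 ∘ ofComplex) (2 * π * I * ((E2 z ^ 2 - E₄ z) / 12)) z := by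
  convert hasDerivAt_comp_ofComplex E2_mdifferentiable z using 2
  have h := serreDerivative_E2 z
  rw [serreDerivative_apply] at h
  linear_combination -h

/-- Klein's invariant in terms of the normalised Eisenstein series. -/
noncomputable def eisensteinJ (z : ℍ) : ℂ := E₄ z ^ 3 / (E₄ z ^ 3 - E₆ z ^ 2)

theorem E₄_cube_sub_E₆_sq_ne_zero (z : ℍ) : E₄ z ^ 3 - E₆ z ^ 2 ≠ 0 := by
  have h := discriminant_eq_E₄_cube_sub_E₆_sq z
  intro h0
  rw [h0, zero_div] at h
  exact discriminant_ne_zero z h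

theorem E₄_ne_zero {z : ℍ} (h : eisensteinJ z ≠ 0) : E₄ z ≠ 0 := by
  rintro h0
  exact h (by simp [eisensteinJ, h0])

theorem E₆_ne_zero {z : ℍ} (h : eisensteinJ z ≠ 1) : E₆ z ≠ 0 := by
  rintro h0
  have h1 := E₄_cube_sub_E₆_sq_ne_zero z
  refine h ?_
  rw [eisensteinJ, h0, zero_pow two_ne_zero, sub_zero, div_self]
  simpa [h0] using h1

/-- Read as `J / (J - 1) = E₄ ^ 3 / E₆ ^ 2`, this is what makes coefficients rational in `J`. -/
theorem E₄_cube_mul (z : ℍ) : E₄ z ^ 3 * (eisensteinJ z - 1) = eisensteinJ z * E₆ z ^ 2 := by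
  have h1 := E₄_cube_sub_E₆_sq_ne_zero z
  rw [eisensteinJ]
  field_simp
  ring

/-- The `E2` terms cancel because `J` has weight zero. -/
theorem hasDerivAt_eisensteinJ {z : ℍ} (h1 : eisensteinJ z ≠ 0) :
    HasDerivAt (eisensteinJ ∘ ofComplex)
      (-(2 * π * I * (eisensteinJ z * E₆ z / E₄ z))) z := by
  have h4 := E₄_ne_zero h1
  have hd := E₄_cube_sub_E₆_sq_ne_zero z
  have h := ((hasDerivAt_E₄ z).pow 3).div
    (((hasDerivAt_E₄ z).pow 3).sub ((hasDerivAt_E₆ z).pow 2)) (by simpa using hd)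
  refine (h.congr_deriv ?_)
  simp only [Pi.pow_apply, Pi.sub_apply, Function.comp_apply, ofComplex_apply, eisensteinJ]
  field_simp
  ring

theorem eisensteinJ_deriv_ne_zero {z : ℍ} (h0 : eisensteinJ z ≠ 0) (h1 : eisensteinJ z ≠ 1) :
    -(2 * π * I * (eisensteinJ z * E₆ z / E₄ z)) ≠ 0 :=
  neg_ne_zero.mpr (mul_ne_zero two_pi_I_ne_zero
    (div_ne_zero (mul_ne_zero h0 (E₆_ne_zero h1)) (E₄_ne_zero h0)))

/-- The slope of `a` is the slope of `a ^ 2` divided by `a y + a x`, which tends to `2 * a x` by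
continuity. -/
theorem HasDerivAt.of_sq {a : ℂ → ℂ} {x d : ℂ} (ha : ContinuousAt a x) (hx : a x ≠ 0)
    (h : HasDerivAt (fun y ↦ a y ^ 2) d x) : HasDerivAt a (d / (2 * a x)) x := by
  rw [hasDerivAt_iff_tendsto_slope] at h ⊢
  have hs : Tendsto (fun y ↦ a y + a x) (𝓝[≠] x) (𝓝 (2 * a x)) := by
    rw [two_mul]
    exact (ha.tendsto.add_const _).mono_left nhdsWithin_le_nhds
  have h2 : (2 * a x) ≠ 0 := mul_ne_zero two_ne_zero hx
  refine (h.div hs h2).congr' ?_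
  filter_upwards [hs.eventually_ne h2] with y hy
  simp only [slope_def_field, Pi.div_apply]
  rw [div_div, mul_comm, ← div_div]
  congr 1
  field_simp
  ring

/-! ### Derivatives in `J` along a section `σ` of Klein's invariant -/

section PicardFuchs

variable {U : Set ℂ} {σ : ℂ → ℍ} {a : ℂ → ℂ}

theorem hasDerivAt_inverse_eisensteinJ (hU : IsOpen U) (h0 : 0 ∉ U) (h1 : 1 ∉ U)
    (hσ : ContinuousOn (fun J ↦ (σ J : ℂ)) U) (hJ : ∀ J ∈ U, eisensteinJ (σ J) = J)
    {J : ℂ} (hJU : J ∈ U) :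
    HasDerivAt (fun J ↦ (σ J : ℂ)) (-(E₄ (σ J) / (2 * π * I * J * E₆ (σ J)))) J := by
  have hj := hJ J hJU
  have hj0 : eisensteinJ (σ J) ≠ 0 := by rw [hj]; exact ne_of_mem_of_not_mem hJU h0
  have hj1 : eisensteinJ (σ J) ≠ 1 := by rw [hj]; exact ne_of_mem_of_not_mem hJU h1
  have h := HasDerivAt.of_local_left_inverse (hσ.continuousAt (hU.mem_nhds hJU))
    (hasDerivAt_eisensteinJ hj0) (eisensteinJ_deriv_ne_zero hj0 hj1) (by
      filter_upwards [hU.mem_nhds hJU] with y hy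
      simp [ofComplex_apply, hJ y hy])
  refine h.congr_deriv ?_
  rw [hj, inv_neg, ← mul_div_assoc, inv_div, mul_assoc (2 * π * I : ℂ)]

theorem hasDerivAt_comp_section {f : ℍ → ℂ} {d s J : ℂ} (hf : HasDerivAt (f ∘ ofComplex) d (σ J))
    (hσ : HasDerivAt (fun J ↦ (σ J : ℂ)) s J) : HasDerivAt (fun J ↦ f (σ J)) (d * s) J := by
  have h := HasDerivAt.comp J hf hσ
  simpa [Function.comp_def, ofComplex_apply] using h

/-- The quasi-modular coefficient `E₂ E₄ / E₆`. -/
noncomputable def eisensteinX (z : ℍ) : ℂ := E2 z * E₄ z / E₆ z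

theorem hasDerivAt_eisensteinX (hU : IsOpen U) (h0 : 0 ∉ U) (h1 : 1 ∉ U)
    (hσ : ContinuousOn (fun J ↦ (σ J : ℂ)) U) (hJ : ∀ J ∈ U, eisensteinJ (σ J) = J)
    {J : ℂ} (hJU : J ∈ U) :
    HasDerivAt (fun J ↦ eisensteinX (σ J))
      (-(1 / J) * (-eisensteinX (σ J) ^ 2 / 12 - J / (12 * (J - 1)) - eisensteinX (σ J) / 3 +
        eisensteinX (σ J) * J / (2 * (J - 1)))) J := by
  have hs := hasDerivAt_inverse_eisensteinJ hU h0 h1 hσ hJ hJU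
  have hj := hJ J hJU
  have hJ0 : J ≠ 0 := ne_of_mem_of_not_mem hJU h0
  have hJ1 : J - 1 ≠ 0 := sub_ne_zero.mpr (ne_of_mem_of_not_mem hJU h1)
  have h4 : E₄ (σ J) ≠ 0 := E₄_ne_zero (by rwa [hj])
  have h6 : E₆ (σ J) ≠ 0 := E₆_ne_zero (by rw [hj]; exact sub_ne_zero.mp hJ1)
  have hc := E₄_cube_mul (σ J)
  rw [hj] at hc
  have ht : J / (J - 1) = E₄ (σ J) ^ 3 / E₆ (σ J) ^ 2 := by
    rw [div_eq_div_iff hJ1 (pow_ne_zero 2 h6), hc]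
  have h := ((hasDerivAt_comp_section (hasDerivAt_E2 _) hs).mul
    (hasDerivAt_comp_section (hasDerivAt_E₄ _) hs)).div
    (hasDerivAt_comp_section (hasDerivAt_E₆ _) hs) h6
  refine h.congr_deriv ?_
  have e1 : J / (12 * (J - 1)) = E₄ (σ J) ^ 3 / E₆ (σ J) ^ 2 / 12 := by
    rw [← ht, div_div, mul_comm]
  have e2 : eisensteinX (σ J) * J / (2 * (J - 1)) =
      eisensteinX (σ J) * (E₄ (σ J) ^ 3 / E₆ (σ J) ^ 2) / 2 := by
    rw [← ht]
    field_simp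
  rw [e1, e2, eisensteinX]
  simp only [Pi.mul_apply]
  have hI := I_ne_zero
  have hπ : (π : ℂ) ≠ 0 := ofReal_ne_zero.mpr pi_ne_zero
  field_simp
  ring

theorem hasDerivAt_E₄_div_E₆ (hU : IsOpen U) (h0 : 0 ∉ U) (h1 : 1 ∉ U)
    (hσ : ContinuousOn (fun J ↦ (σ J : ℂ)) U) (hJ : ∀ J ∈ U, eisensteinJ (σ J) = J)
    {J : ℂ} (hJU : J ∈ U) :
    HasDerivAt (fun J ↦ E₄ (σ J) / E₆ (σ J))
      (-(E₄ (σ J) / E₆ (σ J) / J) *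
        (-eisensteinX (σ J) / 6 - 1 / 3 + J / (2 * (J - 1)))) J := by
  have hs := hasDerivAt_inverse_eisensteinJ hU h0 h1 hσ hJ hJU
  have hj := hJ J hJU
  have hJ0 : J ≠ 0 := ne_of_mem_of_not_mem hJU h0
  have hJ1 : J - 1 ≠ 0 := sub_ne_zero.mpr (ne_of_mem_of_not_mem hJU h1)
  have h4 : E₄ (σ J) ≠ 0 := E₄_ne_zero (by rwa [hj])
  have h6 : E₆ (σ J) ≠ 0 := E₆_ne_zero (by rw [hj]; exact sub_ne_zero.mp hJ1)
  have hc := E₄_cube_mul (σ J)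
  rw [hj] at hc
  have ht : J / (J - 1) = E₄ (σ J) ^ 3 / E₆ (σ J) ^ 2 := by
    rw [div_eq_div_iff hJ1 (pow_ne_zero 2 h6), hc]
  have h := (hasDerivAt_comp_section (hasDerivAt_E₄ _) hs).div
    (hasDerivAt_comp_section (hasDerivAt_E₆ _) hs) h6
  refine h.congr_deriv ?_
  have e1 : J / (2 * (J - 1)) = E₄ (σ J) ^ 3 / E₆ (σ J) ^ 2 / 2 := by
    rw [← ht, div_div, mul_comm]
  rw [e1, eisensteinX]
  have hI := I_ne_zero
  have hπ : (π : ℂ) ≠ 0 := ofReal_ne_zero.mpr pi_ne_zero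
  field_simp
  ring

/-- `a ^ 2` is `c` divided by `E₄ / E₆`, so `a' / a` is minus half the logarithmic derivative of `E₄
/ E₆`. -/
theorem hasDerivAt_period (hU : IsOpen U) (h0 : 0 ∉ U) (h1 : 1 ∉ U)
    (hσ : ContinuousOn (fun J ↦ (σ J : ℂ)) U) (hJ : ∀ J ∈ U, eisensteinJ (σ J) = J)
    (ha : ContinuousOn a U) {c : ℂ} (hc : c ≠ 0)
    (hsq : ∀ J ∈ U, a J ^ 2 = c * (E₆ (σ J) / E₄ (σ J)))
    {J : ℂ} (hJU : J ∈ U) :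
    HasDerivAt a (-(a J / J) * (eisensteinX (σ J) / 12 - J / (4 * (J - 1)) + 1 / 6)) J := by
  have hj := hJ J hJU
  have hJ0 : J ≠ 0 := ne_of_mem_of_not_mem hJU h0
  have hJ1 : J - 1 ≠ 0 := sub_ne_zero.mpr (ne_of_mem_of_not_mem hJU h1)
  have h4 : E₄ (σ J) ≠ 0 := E₄_ne_zero (by rwa [hj])
  have h6 : E₆ (σ J) ≠ 0 := E₆_ne_zero (by rw [hj]; exact sub_ne_zero.mp hJ1)
  have hY := hasDerivAt_E₄_div_E₆ hU h0 h1 hσ hJ hJU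
  have hsqJ := hsq J hJU
  have ha0 : a J ≠ 0 := fun h ↦ by
    rw [h, zero_pow two_ne_zero] at hsqJ
    exact mul_ne_zero hc (div_ne_zero h6 h4) hsqJ.symm
  have h := (hY.inv (div_ne_zero h4 h6)).const_mul c
  have h2 := HasDerivAt.of_sq (ha.continuousAt (hU.mem_nhds hJU)) ha0
    (h.congr_of_eventuallyEq (by
      filter_upwards [hU.mem_nhds hJU] with y hy
      rw [hsq y hy, Pi.inv_apply, inv_div]))
  refine h2.congr_deriv ?_
  have e : ∀ x : ℂ, c * (-(-(E₄ (σ J) / E₆ (σ J) / J) * x) / (E₄ (σ J) / E₆ (σ J)) ^ 2) =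
      a J ^ 2 * (x / J) := by
    intro x
    rw [hsqJ]
    field_simp
  rw [e]
  field_simp
  ring

theorem solvesPicardFuchs_periods (hU : IsOpen U) (h0 : 0 ∉ U) (h1 : 1 ∉ U)
    (hσ : ContinuousOn (fun J ↦ (σ J : ℂ)) U) (hJ : ∀ J ∈ U, eisensteinJ (σ J) = J)
    (ha : ContinuousOn a U) {c : ℂ} (hc : c ≠ 0)
    (hsq : ∀ J ∈ U, a J ^ 2 = c * (E₆ (σ J) / E₄ (σ J))) :
    SolvesPicardFuchs U a ∧ SolvesPicardFuchs U (fun J ↦ a J * σ J) := by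
  have hA {J : ℂ} (hJU : J ∈ U) := hasDerivAt_period hU h0 h1 hσ hJ ha hc hsq hJU
  have hS {J : ℂ} (hJU : J ∈ U) := hasDerivAt_inverse_eisensteinJ hU h0 h1 hσ hJ hJU
  have hA2 : ∀ J ∈ U, HasDerivAt (deriv a)
      (-deriv a J / J - (31 * J - 4) / (144 * J ^ 2 * (J - 1) ^ 2) * a J) J := by
    intro J hJU
    have hJ0 : J ≠ 0 := ne_of_mem_of_not_mem hJU h0
    have hJ1 : J - 1 ≠ 0 := sub_ne_zero.mpr (ne_of_mem_of_not_mem hJU h1)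
    have hX := hasDerivAt_eisensteinX hU h0 h1 hσ hJ hJU
    have hid := hasDerivAt_id J
    have h := ((hA hJU).div hid hJ0).neg.mul
      (((hX.div_const 12).sub (hid.div ((hid.sub_const 1).const_mul 4)
        (mul_ne_zero (by norm_num) hJ1))).add_const (1 / 6))
    refine (h.congr_of_eventuallyEq ?_).congr_deriv ?_
    · filter_upwards [hU.mem_nhds hJU] with y hy
      rw [(hA hy).deriv]
      simp
    · rw [(hA hJU).deriv]
      simp only [Pi.neg_apply, Pi.div_apply, Pi.sub_apply, id]
      field_simp
      ring
  have hB {J : ℂ} (hJU : J ∈ U) := (hA hJU).mul (hS hJU)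
  refine ⟨⟨fun J hJU ↦ (hA hJU).differentiableAt.differentiableWithinAt, fun J hJU ↦ ?_⟩,
    ⟨fun J hJU ↦ (hB hJU).differentiableAt.differentiableWithinAt, fun J hJU ↦ ?_⟩⟩
  · rw [(hA2 J hJU).deriv]
    ring
  · have hJ0 : J ≠ 0 := ne_of_mem_of_not_mem hJU h0
    have hJ1 : J - 1 ≠ 0 := sub_ne_zero.mpr (ne_of_mem_of_not_mem hJU h1)
    have hY := hasDerivAt_E₄_div_E₆ hU h0 h1 hσ hJ hJU
    have hid := hasDerivAt_id J
    -- Written through `Y = E₄ / E₆`, whose logarithmic derivative is `-2 * a' / a`; hence `J * a ^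
    -- 2 * σ'` has derivative zero.
    have hS' {J : ℂ} (hJU : J ∈ U) : HasDerivAt (fun J ↦ (σ J : ℂ))
        (-((2 * π * I)⁻¹ * (E₄ (σ J) / E₆ (σ J) / J))) J := by
      refine (hS hJU).congr_deriv ?_
      have hI := I_ne_zero
      have hπ : (π : ℂ) ≠ 0 := ofReal_ne_zero.mpr pi_ne_zero
      have hJ0 : J ≠ 0 := ne_of_mem_of_not_mem hJU h0
      rw [div_div, inv_mul_eq_div, div_div]
      congr 2
      ring
    have h := ((hA2 J hJU).mul (hS' hJU)).add
      ((hA hJU).mul (((hY.div hid hJ0).const_mul (2 * π * I : ℂ)⁻¹).neg))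
    have hd : HasDerivAt (deriv (fun J ↦ a J * (σ J : ℂ))) _ J := h.congr_of_eventuallyEq (by
      filter_upwards [hU.mem_nhds hJU] with y hy
      have := ((hA hy).mul (hS' hy)).deriv
      rw [← (hA hy).deriv] at this
      simpa using! this)
    rw [hd.deriv, show deriv (fun J ↦ a J * (σ J : ℂ)) J = _ from ((hA hJU).mul (hS' hJU)).deriv,
      (hA hJU).deriv]
    simp only [Pi.neg_apply, Pi.div_apply, id]
    generalize E₄ (σ J) / E₆ (σ J) = Y
    field_simp
    ring

end PicardFuchs

/-! ### Locality of the equation; normalized pairs -/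

theorem SolvesPicardFuchs.congr {U : Set ℂ} {f g : ℂ → ℂ} (hU : IsOpen U)
    (hf : SolvesPicardFuchs U f) (h : ∀ J ∈ U, g J = f J) : SolvesPicardFuchs U g := by
  refine ⟨hf.1.congr h, fun J hJ ↦ ?_⟩
  have he : g =ᶠ[𝓝 J] f := by
    filter_upwards [hU.mem_nhds hJ] with y hy using h y hy
  rw [he.deriv.deriv_eq, he.deriv_eq, h J hJ]
  exact hf.2 J hJ

theorem solvesPicardFuchs_of_locally {U : Set ℂ} {f : ℂ → ℂ}
    (h : ∀ J ∈ U, ∃ V, IsOpen V ∧ J ∈ V ∧ SolvesPicardFuchs V f) : SolvesPicardFuchs U f := by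
  constructor
  · intro J hJ
    obtain ⟨V, hV, hJV, hs⟩ := h J hJ
    exact ((hs.1 J hJV).differentiableAt (hV.mem_nhds hJV)).differentiableWithinAt
  · intro J hJ
    obtain ⟨V, -, hJV, hs⟩ := h J hJ
    exact hs.2 J hJV

theorem tauPair_g₃_div_g₂ (τ : ℍ) :
    (tauPair τ).g₃ / (tauPair τ).g₂ = 2 / 9 * π ^ 2 * (E₆ τ / E₄ τ) := by
  have hπ : (π : ℂ) ≠ 0 := ofReal_ne_zero.mpr pi_ne_zero
  rw [tauPair_g₂, tauPair_g₃, mul_div_mul_comm]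
  congr 1
  field_simp
  norm_num

theorem normalizing_factor_ne_zero {τ : ℍ} {μ : ℂ} (h0 : eisensteinJ τ ≠ 0) (h1 : eisensteinJ τ ≠ 1)
    (hμ : μ ^ 2 = (tauPair τ).g₃ / (tauPair τ).g₂) : μ ≠ 0 := by
  rintro rfl
  rw [tauPair_g₃_div_g₂, zero_pow two_ne_zero] at hμ
  have hπ : (2 / 9 * π ^ 2 : ℂ) ≠ 0 := by simp [pi_ne_zero]
  exact mul_ne_zero hπ (div_ne_zero (E₆_ne_zero h1) (E₄_ne_zero h0)) hμ.symm

theorem isNormalizedPair_ofTau {J : ℂ} {τ : ℍ} {μ : ℂ} (hμ0 : μ ≠ 0) (hJ : eisensteinJ τ = J)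
    (hμ : μ ^ 2 = (tauPair τ).g₃ / (tauPair τ).g₂) :
    IsNormalizedPair J (PeriodPair.ofTau τ μ hμ0) :=
  ⟨τ, μ, (kleinJ_tauPair τ).trans hJ, hμ, PeriodPair.lattice_eq_image_of_tau rfl⟩

/-- With `μ ^ 2 = g₃ / g₂`, both `μ⁻⁴ g₂` and `μ⁻⁶ g₃` equal `g₂³ / g₃²`. -/
theorem IsNormalizedPair.invariants {J : ℂ} {L : PeriodPair} (h0 : J ≠ 0) (h1 : J ≠ 1)
    (h : IsNormalizedPair J L) : L.g₂ = 27 * J / (J - 1) ∧ L.g₃ = 27 * J / (J - 1) := by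
  obtain ⟨τ, μ, hJ, hμ, hL⟩ := h
  have hj : eisensteinJ τ = J := (kleinJ_tauPair τ).symm.trans hJ
  have hj0 : eisensteinJ τ ≠ 0 := hj ▸ h0
  have hj1 : eisensteinJ τ ≠ 1 := hj ▸ h1
  have hμ0 := normalizing_factor_ne_zero hj0 hj1 hμ
  have h4 := E₄_ne_zero hj0
  have h6 := E₆_ne_zero hj1
  have hJ1 := sub_ne_zero.mpr h1
  have hc := E₄_cube_mul τ
  rw [hj] at hc
  have hπ : (π : ℂ) ≠ 0 := ofReal_ne_zero.mpr pi_ne_zero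
  rw [PeriodPair.g₂_of_lattice_eq_image hμ0 hL, PeriodPair.g₃_of_lattice_eq_image hμ0 hL,
    show μ ^ 4 = (μ ^ 2) ^ 2 by ring, show μ ^ 6 = (μ ^ 2) ^ 3 by ring, hμ, tauPair_g₃_div_g₂,
    tauPair_g₂, tauPair_g₃]
  constructor
  · field_simp
    linear_combination 324 * hc
  · field_simp
    linear_combination 5832 * hc

theorem isNormalizedPair_congr {J : ℂ} {L L' : PeriodPair} (h : L.lattice = L'.lattice) :
    IsNormalizedPair J L ↔ IsNormalizedPair J L' := by
  rw [IsNormalizedPair, IsNormalizedPair, h]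

theorem isNormalizedPair_swap {J : ℂ} {L : PeriodPair} :
    IsNormalizedPair J L.swap ↔ IsNormalizedPair J L :=
  isNormalizedPair_congr L.swap_lattice

/-- A positively oriented pair of basic periods of a normalized lattice satisfies the normalization
condition with respect to its own quotient. -/
theorem IsNormalizedPair.of_tau {J : ℂ} {L : PeriodPair} (h0 : J ≠ 0) (h1 : J ≠ 1)
    (h : IsNormalizedPair J L) {τ : ℍ} (hτ : L.ω₂ = L.ω₁ * τ) :
    eisensteinJ τ = J ∧ L.ω₁ ^ 2 = (tauPair τ).g₃ / (tauPair τ).g₂ := by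
  obtain ⟨h2, h3⟩ := h.invariants h0 h1
  have hL := PeriodPair.lattice_eq_image_of_tau hτ
  have hω := L.ω₁_ne_zero
  have hJ1 := sub_ne_zero.mpr h1
  -- The `τ` that witnesses `h` may come from another basis. No change of basis is needed: the known
  -- invariants of `L` and scaling determine those of `L_τ`.
  have e2 : (tauPair τ).g₂ = L.ω₁ ^ 4 * (27 * J / (J - 1)) := by
    rw [← h2, PeriodPair.g₂_of_lattice_eq_image hω hL, mul_inv_cancel_left₀ (pow_ne_zero _ hω)]
  have e3 : (tauPair τ).g₃ = L.ω₁ ^ 6 * (27 * J / (J - 1)) := by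
    rw [← h3, PeriodPair.g₃_of_lattice_eq_image hω hL, mul_inv_cancel_left₀ (pow_ne_zero _ hω)]
  have hg : 27 * J / (J - 1) ≠ 0 := div_ne_zero (mul_ne_zero (by norm_num) h0) hJ1
  constructor
  · rw [eisensteinJ, ← kleinJ_tauPair, kleinJ, e2, e3]
    have e : (L.ω₁ ^ 4 * (27 * J / (J - 1))) ^ 3 - 27 * (L.ω₁ ^ 6 * (27 * J / (J - 1))) ^ 2 =
        L.ω₁ ^ 12 * (27 * J / (J - 1)) ^ 2 * (27 / (J - 1)) := by
      field_simp
      ring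
    rw [e]
    field_simp
  · rw [e2, e3, mul_div_mul_right _ _ hg]
    field_simp

/-! ### Period branches and their orientation -/

theorem IsPeriodBranch.swap {U : Set ℂ} {L : ℂ → PeriodPair} (h : IsPeriodBranch U L) :
    IsPeriodBranch U fun J ↦ (L J).swap :=
  ⟨h.2.1, h.1, fun J hJ ↦ isNormalizedPair_swap.mpr (h.2.2 J hJ)⟩

theorem IsPeriodBranch.mono {U V : Set ℂ} {L : ℂ → PeriodPair} (h : IsPeriodBranch U L)
    (hV : V ⊆ U) : IsPeriodBranch V L :=
  ⟨h.1.mono hV, h.2.1.mono hV, fun J hJ ↦ h.2.2 J (hV hJ)⟩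

theorem IsPeriodBranch.solvesPicardFuchs_of_im_pos {U : Set ℂ} {L : ℂ → PeriodPair} (hU : IsOpen U)
    (h0 : 0 ∉ U) (h1 : 1 ∉ U) (h : IsPeriodBranch U L)
    (him : ∀ J ∈ U, 0 < ((L J).ω₂ / (L J).ω₁).im) :
    SolvesPicardFuchs U (fun J => (L J).ω₁) ∧ SolvesPicardFuchs U (fun J => (L J).ω₂) := by
  have hσ : ∀ J ∈ U, (ofComplex ((L J).ω₂ / (L J).ω₁) : ℂ) = (L J).ω₂ / (L J).ω₁ :=
    fun J hJ ↦ by rw [ofComplex_apply_of_im_pos (him J hJ)]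
  have hτ : ∀ J ∈ U, (L J).ω₂ = (L J).ω₁ * (ofComplex ((L J).ω₂ / (L J).ω₁) : ℂ) :=
    fun J hJ ↦ by rw [hσ J hJ, mul_div_cancel₀ _ (L J).ω₁_ne_zero]
  have hn : ∀ J ∈ U, _ := fun J hJ ↦ (h.2.2 J hJ).of_tau (ne_of_mem_of_not_mem hJ h0)
    (ne_of_mem_of_not_mem hJ h1) (hτ J hJ)
  have hc : (2 / 9 * π ^ 2 : ℂ) ≠ 0 := by simp [pi_ne_zero]
  have hs := solvesPicardFuchs_periods (σ := fun J ↦ ofComplex ((L J).ω₂ / (L J).ω₁))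
    (a := fun J ↦ (L J).ω₁) hU h0 h1
    ((h.2.1.div h.1 fun J _ ↦ (L J).ω₁_ne_zero).congr hσ) (fun J hJ ↦ (hn J hJ).1) h.1 hc
    (fun J hJ ↦ by rw [← tauPair_g₃_div_g₂]; exact (hn J hJ).2)
  exact ⟨hs.1, hs.2.congr hU hτ⟩

theorem IsPeriodBranch.exists_nhds_im_pos {U : Set ℂ} {L : ℂ → PeriodPair} (hU : IsOpen U)
    (h : IsPeriodBranch U L) {J : ℂ} (hJ : J ∈ U) (him : 0 < ((L J).ω₂ / (L J).ω₁).im) :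
    ∃ V ⊆ U, IsOpen V ∧ J ∈ V ∧ ∀ y ∈ V, 0 < ((L y).ω₂ / (L y).ω₁).im := by
  have hc : ContinuousOn (fun y ↦ ((L y).ω₂ / (L y).ω₁).im) U :=
    continuous_im.comp_continuousOn (h.2.1.div h.1 fun J _ ↦ (L J).ω₁_ne_zero)
  exact ⟨_, Set.inter_subset_left, hc.isOpen_inter_preimage hU isOpen_Ioi, ⟨hJ, him⟩,
    fun y hy ↦ hy.2⟩

/-- Orientation is locally constant, and exchanging the periods makes it positive; it may differ
between components of `U`, so the argument is local. -/
theorem IsPeriodBranch.exists_nhds_solvesPicardFuchs {U : Set ℂ} {L : ℂ → PeriodPair}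
    (hU : IsOpen U) (h0 : 0 ∉ U) (h1 : 1 ∉ U) (h : IsPeriodBranch U L) {J : ℂ} (hJ : J ∈ U) :
    ∃ V, IsOpen V ∧ J ∈ V ∧
      SolvesPicardFuchs V (fun J => (L J).ω₁) ∧ SolvesPicardFuchs V (fun J => (L J).ω₂) := by
  by_cases him : 0 < ((L J).ω₂ / (L J).ω₁).im
  · obtain ⟨V, hVU, hV, hJV, hp⟩ := h.exists_nhds_im_pos hU hJ him
    exact ⟨V, hV, hJV, (h.mono hVU).solvesPicardFuchs_of_im_pos hV (fun hm ↦ h0 (hVU hm))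
      (fun hm ↦ h1 (hVU hm)) hp⟩
  · obtain ⟨V, hVU, hV, hJV, hp⟩ :=
      h.swap.exists_nhds_im_pos hU hJ (PeriodPair.im_swap_div_pos him)
    exact ⟨V, hV, hJV, ((h.swap.mono hVU).solvesPicardFuchs_of_im_pos hV (fun hm ↦ h0 (hVU hm))
      (fun hm ↦ h1 (hVU hm)) hp).symm⟩

/-! ### Local existence of branches -/

/-- Near a point where `J ≠ 0, 1`, Klein's invariant has a continuous local inverse. -/
theorem exists_local_section_eisensteinJ {τ : ℍ} (h0 : eisensteinJ τ ≠ 0)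
    (h1 : eisensteinJ τ ≠ 1) :
    ∃ σ : ℂ → ℍ, σ (eisensteinJ τ) = τ ∧ ∀ᶠ J in 𝓝 (eisensteinJ τ),
      eisensteinJ (σ J) = J ∧ ContinuousAt σ J := by
  have hM : MDiff eisensteinJ :=
    ((ModularFormClass.holo E₄).pow 3).div
      (((ModularFormClass.holo E₄).pow 3).sub ((ModularFormClass.holo E₆).pow 2))
      E₄_cube_sub_E₆_sq_ne_zero
  have han : AnalyticAt ℂ (eisensteinJ ∘ ofComplex) τ :=
    (UpperHalfPlane.mdifferentiable_iff.mp hM).analyticAt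
      (isOpen_upperHalfPlaneSet.mem_nhds τ.im_pos)
  have hd := han.hasStrictDerivAt
  rw [(hasDerivAt_eisensteinJ h0).deriv] at hd
  have hne := eisensteinJ_deriv_ne_zero h0 h1
  let e := (hd.hasStrictFDerivAt_equiv hne).toOpenPartialHomeomorph _
  have he : ∀ z, e z = (eisensteinJ ∘ ofComplex) z := fun z ↦ rfl
  have hsrc : (τ : ℂ) ∈ e.source :=
    (hd.hasStrictFDerivAt_equiv hne).mem_toOpenPartialHomeomorph_source
  have heτ : e τ = eisensteinJ τ := by simp [he, ofComplex_apply]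
  have htgt : eisensteinJ τ ∈ e.target := heτ ▸ e.map_source hsrc
  have hinv : e.symm (eisensteinJ τ) = τ := heτ ▸ e.left_inv hsrc
  have hcont : ContinuousAt e.symm (eisensteinJ τ) := e.continuousAt_symm htgt
  have him : ∀ᶠ J in 𝓝 (eisensteinJ τ), 0 < (e.symm J).im :=
    hcont.eventually (by rw [hinv]; exact isOpen_upperHalfPlaneSet.mem_nhds τ.im_pos)
  refine ⟨fun J ↦ ofComplex (e.symm J), by simp only [hinv, ofComplex_apply], ?_⟩
  filter_upwards [e.open_target.mem_nhds htgt, him] with J hJ hJim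
  -- `e` is Klein's invariant after `ofComplex`, so its right inverse law is already the section
  -- equation; `hJim` serves only continuity.
  refine ⟨e.right_inv hJ, ?_⟩
  have hc := e.continuousAt_symm hJ
  have h2 : ContinuousAt ofComplex (e.symm J) := by
    exact (contMDiffAt_ofComplex (n := 0) hJim).continuousAt
  exact h2.comp hc

theorem exists_periodBranch_of_im_pos {J₀ : ℂ} {L₀ : PeriodPair} (h0 : J₀ ≠ 0) (h1 : J₀ ≠ 1)
    (h : IsNormalizedPair J₀ L₀) (him : 0 < (L₀.ω₂ / L₀.ω₁).im) :
    ∃ (U : Set ℂ) (L : ℂ → PeriodPair), IsOpen U ∧ J₀ ∈ U ∧ 0 ∉ U ∧ 1 ∉ U ∧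
        IsPeriodBranch U L ∧ L J₀ = L₀ := by
  classical
  obtain ⟨τ, hτ⟩ : ∃ τ : ℍ, L₀.ω₂ = L₀.ω₁ * τ :=
    ⟨⟨_, him⟩, (mul_div_cancel₀ _ L₀.ω₁_ne_zero).symm⟩
  obtain ⟨hJ, hω⟩ := h.of_tau h0 h1 hτ
  rw [tauPair_g₃_div_g₂] at hω
  obtain ⟨σ, hστ, hσ⟩ := exists_local_section_eisensteinJ (hJ ▸ h0) (hJ ▸ h1)
  rw [hJ] at hστ hσ
  have hω0 := L₀.ω₁_ne_zero
  -- The required `ω₁ ^ 2` relative to its value at `J₀`. As `m J₀ = 1`, the principal square root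
  -- of `m` is continuous nearby and takes the value `1` there.
  let m : ℂ → ℂ := fun J ↦ 2 / 9 * π ^ 2 * (E₆ (σ J) / E₄ (σ J)) / L₀.ω₁ ^ 2
  let a : ℂ → ℂ := fun J ↦ L₀.ω₁ * m J ^ (1 / 2 : ℂ)
  have hm0 : m J₀ = 1 := by
    simp only [m, hστ]
    rw [← hω, div_self (pow_ne_zero 2 hω0)]
  have ha0 : a J₀ = L₀.ω₁ := by simp [a, hm0]
  have hm : ∀ J, J ≠ 0 → eisensteinJ (σ J) = J → ContinuousAt σ J → ContinuousAt m J := by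
    intro J hJ0 hJσ hc
    have h6 : ContinuousAt (fun J ↦ E₆ (σ J)) J :=
      (ModularFormClass.holo E₆).continuous.continuousAt.comp hc
    have h4 : ContinuousAt (fun J ↦ E₄ (σ J)) J :=
      (ModularFormClass.holo E₄).continuous.continuousAt.comp hc
    exact ((h6.div h4 (E₄_ne_zero (by rwa [hJσ]))).const_mul _).div_const _
  have hslit : ∀ᶠ J in 𝓝 J₀, m J ∈ slitPlane :=
    (hm J₀ h0 hσ.self_of_nhds.1 hσ.self_of_nhds.2).eventually
      (isOpen_slitPlane.mem_nhds (by rw [hm0]; exact one_mem_slitPlane))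
  have hall := (hσ.and hslit).and ((eventually_ne_nhds h0).and (eventually_ne_nhds h1))
  obtain ⟨U, hU, hUo, hJU⟩ := eventually_nhds_iff.mp hall
  have hane : ∀ J ∈ U, a J ≠ 0 := fun J hJ ↦
    mul_ne_zero hω0 (by
      rw [Ne, cpow_eq_zero_iff, not_and_or]
      exact Or.inl (slitPlane_ne_zero (hU J hJ).1.2))
  have hasq : ∀ J, a J ^ 2 = (tauPair (σ J)).g₃ / (tauPair (σ J)).g₂ := by
    intro J
    rw [tauPair_g₃_div_g₂]
    simp only [a, mul_pow]
    rw [← cpow_mul_nat, show (1 / 2 : ℂ) * (2 : ℕ) = 1 by norm_num, cpow_one]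
    exact mul_div_cancel₀ _ (pow_ne_zero 2 hω0)
  -- `L₀` is a filler value, never taken through this branch on `U`.
  let L : ℂ → PeriodPair := fun J ↦
    if hJ : a J ≠ 0 then PeriodPair.ofTau (σ J) (a J) hJ else L₀
  have hL : ∀ J (hJ : J ∈ U), L J = PeriodPair.ofTau (σ J) (a J) (hane J hJ) :=
    fun J hJ ↦ dif_pos (hane J hJ)
  have hca : ContinuousOn a U := fun J hJ ↦ by
    obtain ⟨⟨⟨hj, hc⟩, hs⟩, hJ0, -⟩ := hU J hJ
    exact ((ContinuousAt.cpow (hm J hJ0 hj hc) continuousAt_const hs).const_mul _).continuousWithinAt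
  have hcσ : ContinuousOn (fun J ↦ (σ J : ℂ)) U := fun J hJ ↦
    (UpperHalfPlane.continuous_coe.continuousAt.comp (hU J hJ).1.1.2).continuousWithinAt
  refine ⟨U, L, hUo, hJU, fun hm ↦ (hU 0 hm).2.1 rfl, fun hm ↦ (hU 1 hm).2.2 rfl,
    ⟨hca.congr fun J hJ ↦ by rw [hL J hJ]; rfl,
      (hca.mul hcσ).congr fun J hJ ↦ by rw [hL J hJ]; rfl, fun J hJ ↦ ?_⟩, ?_⟩
  · rw [hL J hJ]
    exact isNormalizedPair_ofTau _ (hU J hJ).1.1.1 (hasq J)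
  · rw [hL J₀ hJU]
    exact PeriodPair.eq_of_periods_eq ha0 (by rw [hτ, ← ha0, ← hστ]; rfl)

theorem exists_periodBranch {J₀ : ℂ} {L₀ : PeriodPair} (h0 : J₀ ≠ 0) (h1 : J₀ ≠ 1)
    (h : IsNormalizedPair J₀ L₀) :
    ∃ (U : Set ℂ) (L : ℂ → PeriodPair), IsOpen U ∧ J₀ ∈ U ∧ 0 ∉ U ∧ 1 ∉ U ∧
        IsPeriodBranch U L ∧ L J₀ = L₀ := by
  by_cases him : 0 < (L₀.ω₂ / L₀.ω₁).im
  · exact exists_periodBranch_of_im_pos h0 h1 h him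
  · obtain ⟨U, L, hU, hJU, hU0, hU1, hb, hL⟩ := exists_periodBranch_of_im_pos h0 h1
      (isNormalizedPair_swap.mpr h) (PeriodPair.im_swap_div_pos him)
    exact ⟨U, fun J ↦ (L J).swap, hU, hJU, hU0, hU1, hb.swap, congrArg PeriodPair.swap hL⟩

theorem mainTheorem5 :
    -- the normalized lattice exists for every value `J(τ) ≠ 0, 1`
    (∀ τ : UpperHalfPlane, kleinJ (tauPair τ) ≠ 0 → kleinJ (tauPair τ) ≠ 1 →
      ∃ L : PeriodPair, IsNormalizedPair (kleinJ (tauPair τ)) L) ∧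
    -- its invariants
    (∀ (J : ℂ) (L : PeriodPair), J ≠ 0 → J ≠ 1 → IsNormalizedPair J L →
      L.g₂ = 27 * J / (J - 1) ∧ L.g₃ = 27 * J / (J - 1)) ∧
    -- the basic periods are, locally, functions of `J`
    (∀ (J₀ : ℂ) (L₀ : PeriodPair), J₀ ≠ 0 → J₀ ≠ 1 → IsNormalizedPair J₀ L₀ →
      ∃ (U : Set ℂ) (L : ℂ → PeriodPair), IsOpen U ∧ J₀ ∈ U ∧ 0 ∉ U ∧ 1 ∉ U ∧
        IsPeriodBranch U L ∧ L J₀ = L₀) ∧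
    -- these functions solve the Picard-Fuchs equation
    (∀ (U : Set ℂ) (L : ℂ → PeriodPair), IsOpen U → 0 ∉ U → 1 ∉ U → IsPeriodBranch U L →
      SolvesPicardFuchs U (fun J => (L J).ω₁) ∧ SolvesPicardFuchs U (fun J => (L J).ω₂)) := by
  refine ⟨fun τ h0 h1 ↦ ?_, fun J L h0 h1 h ↦ h.invariants h0 h1,
    fun J₀ L₀ h0 h1 h ↦ exists_periodBranch h0 h1 h, fun U L hU h0 h1 h ↦ ⟨?_, ?_⟩⟩
  · rw [kleinJ_tauPair] at h0 h1 ⊢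
    obtain ⟨μ, hμ⟩ := IsAlgClosed.exists_pow_nat_eq ((tauPair τ).g₃ / (tauPair τ).g₂) two_pos
    exact ⟨_, isNormalizedPair_ofTau (normalizing_factor_ne_zero h0 h1 hμ) rfl hμ⟩
  · exact solvesPicardFuchs_of_locally fun J hJ ↦
      let ⟨V, hV, hJV, hs⟩ := h.exists_nhds_solvesPicardFuchs hU h0 h1 hJ
      ⟨V, hV, hJV, hs.1⟩
  · exact solvesPicardFuchs_of_locally fun J hJ ↦
      let ⟨V, hV, hJV, hs⟩ := h.exists_nhds_solvesPicardFuchs hU h0 h1 hJ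
      ⟨V, hV, hJV, hs.2⟩
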